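/- **Lemma (Total order).** Single-leader Angelfish satisfies Total order. *Setting.* There are $n$ parties, at most $f$ of them Byzantine, $3f<n$; the others are honest. The network is asynchronous and timers may expire at any time (so all partially synchronous executions are included); the signatures of honest parties cannot be forged; references are collision-free hashes. Rounds are numbered $1,2,\dots$; round $r$ has a predetermined leader $L_r$. A *vertex* has a round, a source, a (possibly empty) block, a propose flag, strong edges (to vertices of the previous round), weak edges (to vertices of earlier rounds), possibly a leader edge, and a set of timeout certificates. The round $r$ vertex of $L_r$ is the round $r$ *leader vertex*; only leader vertices may have a leader edge, which goes to a leader vertex of a round $<r-1$. A *vote* of round $r$ has a propose flag and supports either the round $r-1$ leader vertex or nothing. A timeout certificate $\mathcal{TC}_r$ consists of timeout messages for round $r$ signed by $n-f$ distinct parties. Vertices are disseminated by Byzantine reliable broadcast, with one instance for each source and round: (validity) a vertex broadcast by an honest source is eventually delivered by every honest party; (agreement) if one honest party delivers a vertex, every honest party eventually does; (integrity) an honest party delivers at most once in each instance. Votes, timeouts and certificates are multicast. *Protocol of an honest party $P_i$.* - A delivered well-formed vertex is added to the local graph $DAG_i$ once all the vertices that it references are there. A round $r$ leader vertex is accepted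 only if it has a strong edge to the round $r-1$ leader vertex, or carries $\mathcal{TC}_{r''}$ for all $r'<r''<r$, where $r'$ is the round of its leader edge ($r'=0$ if it has none). - $P_i$ starts in round $1$. It enters round $r+1$ from round $r$ when the numbers of received round $r$ vote signatures (directly or in vote certificates) and of round $r$ vertices in $DAG_i$ add up to at least $n-f$, and from a round $<r$ when they add up to at least $f+1$; in both cases it must have the round $r$ leader vertex or $\mathcal{TC}_r$, and $L_{r+1}$, if it lacks the round $r$ leader vertex, must have the timeout certificates of all rounds up to $r$ after the last round whose leader vertex it has. If its timer expires while its current round's leader vertex is missing, it multicasts a timeout for that round. - In each round that it enters, $P_i$ sends at most one message, a vertex or a vote; $L_r$ never sends a vote in round $r$. Before creating a round $r>1$ vertex, unless it jumped into round $r$, it waits until the number of round $r-1$ vertices in $DAG_i$ is at least the number of parties known to have set the propose flag in round $r-2$, minus $f$. The strong edges of its round $r$ vertex go to all round $r-1$ vertices in $DAG_i$, except the leader vertex if it sent a timeout for round $r-1$; its vote supports the round $r-1$ leader vertex if it has it and did not send that timeout. If its own round $r$ leader vertex has no strong edge to the round $r-1$ leader vertex, it gets a leader edge to the latest leader vertex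 of a round $<r-1$ in $DAG_i$ (if any) and the certificates $\mathcal{TC}$ of all rounds in between. Weak edges go to vertices of $DAG_i$ of rounds $\le r-2$ not reached otherwise; either all vertices of these rounds are then reached or there are at least $n-f$ weak edges. - $P_i$ *directly commits* the round $r$ leader vertex $v\in DAG_i$, if it has not yet directly committed in a round $\ge r$, once at least $n-f$ distinct parties support it, each by the first reliable-broadcast message of a round $r+1$ vertex with a strong edge to the round $r$ leader vertex or by a signed round $r+1$ vote for that vertex (received directly or in a commit vote certificate). It then goes down through the rounds $r-1,r-2,\dots$ to the round after that of its previous direct commit (to round $1$ if there is none), committing each leader vertex in $DAG_i$ that has a leader path from the last vertex committed in this process; a *leader path* is a path through leader vertices along strong edges and leader edges. These leader vertices are processed in increasing order of rounds: for each one, the not yet delivered vertices reachable from it (by strong, weak and leader edges) are output in a fixed deterministic order, a vertex with block $b$, round $r$ and source $P_k$ being output as $\mathsf{a\_deliver}_i(b,r,P_k)$. Byzantine parties behave arbitrarily. *Claim.* In every execution: 1. (Total order) if an honest party $P_i$ outputs $\mathsf{a\_deliver}_i(b,r,P_k)$ before $\mathsf{a\_deliver}_i(b',r',P_\ell)$,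 then no honest party $P_j$ outputs $\mathsf{a\_deliver}_j(b',r',P_\ell)$ before $\mathsf{a\_deliver}_j(b,r,P_k)$. The same holds with the rounds omitted, that is, for the pairs $(b,P_k)$ and $(b',P_\ell)$, where a pair that is output several times counts at its first output: if $P_i$ outputs $(b,P_k)$ before its first output of $(b',P_\ell)$, then no honest $P_j$ outputs $(b',P_\ell)$ before its first output of $(b,P_k)$. 2. If an honest party directly commits a round $r$ leader vertex $v$, then, in the local graph of any honest party at any time, every leader vertex of a round $>r$ has a leader path to $v$. -/

import Mathlib

universe u

namespace Angelfish

/-! ## Data structures -/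

/-- A timeout certificate `TC_r`: signatures of `signers` on the message `⟨timeout, r⟩`. -/
structure TimeoutCert (n : ℕ) where
  round : ℕ
  signers : Finset (Fin n)

/-- A vertex of the DAG. A block is a list of transactions (possibly empty). References are
collision-free hashes, so a vertex is identified with its content together with the vertices
that it references. The lists are used as sets. -/
structure Vertex (n : ℕ) (Tx : Type u) : Type u where
  round : ℕ
  source : Fin n
  block : List Tx
  propose : Bool
  strongEdges : List (Vertex n Tx)
  weakEdges : List (Vertex n Tx)
  leaderEdge : Option (Vertex n Tx)
  tc : List (TimeoutCert n)

noncomputable instance (n : ℕ) (Tx : Type u) : DecidableEq (Vertex n Tx) := Classical.decEq _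

/-- All vertices referenced by `v`. -/
def Vertex.refs {n : ℕ} {Tx : Type u} (v : Vertex n Tx) : List (Vertex n Tx) :=
  v.strongEdges ++ v.weakEdges ++ v.leaderEdge.toList

/-- A vote; `strongEdge` is `none` when the vote supports no leader vertex. -/
structure Vote (n : ℕ) (Tx : Type u) : Type u where
  round : ℕ
  source : Fin n
  propose : Bool
  strongEdge : Option (Vertex n Tx)

/-- The messages that parties multicast. `first v` is the first message of the reliable
broadcast of `v`. The certificates carry the set of parties whose vote signatures they
aggregate: `pvc r Q` (round `r` votes with propose flag true), `npvc r Q` (with flag false),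
`cvc r Q` (round `r` votes for the leader vertex of round `r - 1`). -/
inductive Msg (n : ℕ) (Tx : Type u) : Type u where
  | vote (vt : Vote n Tx)
  | timeout (r : ℕ)
  | first (v : Vertex n Tx)
  | tc (c : TimeoutCert n)
  | pvc (r : ℕ) (signers : Finset (Fin n))
  | npvc (r : ℕ) (signers : Finset (Fin n))
  | cvc (r : ℕ) (signers : Finset (Fin n))

/-- The fixed data of a system of `n` parties: the bound `f` used in the thresholds, the set of
Byzantine parties, the leader of each round, and the deterministic rule by which a finite set of
vertices is listed for delivery. -/
structure System (n : ℕ) (Tx : Type u) where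
  f : ℕ
  byz : Finset (Fin n)
  leader : ℕ → Fin n
  order : Finset (Vertex n Tx) → List (Vertex n Tx)
  order_nodup : ∀ s, (order s).Nodup
  mem_order : ∀ s v, v ∈ order s ↔ v ∈ s

/-- Local variables of a party. Arrays indexed by rounds are functions on `ℕ`; sets of
signatures are the sets of their signers. -/
structure LocalState (n : ℕ) (Tx : Type u) : Type u where
  /-- current round -/
  round : ℕ
  /-- whether the vertex or vote of the current round has been sent -/
  sent : Bool
  /-- whether the current round was entered by a jump -/
  jumped : Bool
  /-- `blocksToPropose` -/
  queue : List (List Tx)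
  dag : Finset (Vertex n Tx)
  buffer : Finset (Vertex n Tx)
  vertexProposers : ℕ → Finset (Fin n)
  sigPropose : ℕ → Finset (Fin n)
  sigNoPropose : ℕ → Finset (Fin n)
  /-- `sigCommit r`: signers of round `r` votes for the leader vertex of round `r - 1` -/
  sigCommit : ℕ → Finset (Fin n)
  /-- rounds for which a timeout message has been sent -/
  timeoutSent : Finset ℕ
  /-- signers of the timeout messages received, individually or inside certificates -/
  timeoutSigs : ℕ → Finset (Fin n)
  /-- first messages received from reliable broadcasts -/
  firstMsgs : Finset (Vertex n Tx)
  committedRound : ℕ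
  delivered : Finset (Vertex n Tx)
  /-- the outputs `a_deliver(block, round, source)`, in the order in which they were made -/
  out : List (List Tx × ℕ × Fin n)

/-- The local state right after `advance_round(1)`. -/
def LocalState.init (n : ℕ) (Tx : Type u) : LocalState n Tx where
  round := 1
  sent := false
  jumped := false
  queue := []
  dag := ∅
  buffer := ∅
  vertexProposers := fun _ => ∅
  sigPropose := fun _ => ∅
  sigNoPropose := fun _ => ∅
  sigCommit := fun _ => ∅
  timeoutSent := ∅
  timeoutSigs := fun _ => ∅
  firstMsgs := ∅
  committedRound := 0
  delivered := ∅
  out := []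

/-- `DAG_i[r]`. -/
def LocalState.layer {n : ℕ} {Tx : Type u} (s : LocalState n Tx) (r : ℕ) :
    Finset (Vertex n Tx) :=
  s.dag.filter (fun v => v.round = r)

/-- `|sigPropose[r]| + |sigNoPropose[r]| + |DAG_i[r]|`. -/
def LocalState.heard {n : ℕ} {Tx : Type u} (s : LocalState n Tx) (r : ℕ) : ℕ :=
  (s.sigPropose r).card + (s.sigNoPropose r).card + (s.layer r).card

/-- The global configuration: the local states (only those of honest parties matter) and the
set of messages multicast so far by honest parties, each with its sender. -/
structure Config (n : ℕ) (Tx : Type u) : Type u where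
  loc : Fin n → LocalState n Tx
  net : Set (Fin n × Msg n Tx)

def Config.init (n : ℕ) (Tx : Type u) : Config n Tx where
  loc := fun _ => LocalState.init n Tx
  net := ∅

/-- Replace the state of party `i` by `s` and add the messages `M`, multicast by `i`. -/
def Config.upd {n : ℕ} {Tx : Type u} (c : Config n Tx) (i : Fin n) (s : LocalState n Tx)
    (M : Set (Msg n Tx)) : Config n Tx where
  loc := Function.update c.loc i s
  net := c.net ∪ (fun m => (i, m)) '' M

namespace System

variable {n : ℕ} {Tx : Type u}

/-! ## Paths and leader vertices -/

/-- Party `i` is honest. -/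
def Honest (S : System n Tx) (i : Fin n) : Prop := i ∉ S.byz

/-- `v` is a leader vertex of round `r`. -/
def IsLeaderVertex (S : System n Tx) (r : ℕ) (v : Vertex n Tx) : Prop :=
  v.round = r ∧ v.source = S.leader r

/-- The party has a round `r` leader vertex in its DAG. -/
def HasLeader (S : System n Tx) (s : LocalState n Tx) (r : ℕ) : Prop :=
  ∃ v ∈ s.dag, S.IsLeaderVertex r v

open Classical in
/-- `get_leader_vertex(r)`. -/
noncomputable def getLeader (S : System n Tx) (s : LocalState n Tx) (r : ℕ) :
    Option (Vertex n Tx) :=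
  if h : S.HasLeader s r then some h.choose else none

/-- `path(v, u)` in the DAG `D`, along strong, weak and leader edges. -/
def Path (D : Finset (Vertex n Tx)) (v u : Vertex n Tx) : Prop :=
  Relation.ReflTransGen (fun a b => b ∈ D ∧ b ∈ a.refs) v u

/-- `leader_path(v, u)` in the DAG `D`: all vertices are leader vertices and all edges are
strong edges or leader edges. -/
def LeaderPath (S : System n Tx) (D : Finset (Vertex n Tx)) (v u : Vertex n Tx) : Prop :=
  S.IsLeaderVertex v.round v ∧
  Relation.ReflTransGen (fun a b => b ∈ D ∧ S.IsLeaderVertex b.round b ∧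
    (b ∈ a.strongEdges ∨ a.leaderEdge = some b)) v u

/-! ## Verification -/

/-- The format of a vertex: strong edges go to the previous round, weak edges to earlier rounds,
and only a leader vertex may have a leader edge, to a leader vertex of a round before the
previous one. -/
def WellFormed (S : System n Tx) (v : Vertex n Tx) : Prop :=
  1 ≤ v.round ∧
  (∀ u ∈ v.strongEdges, u.round + 1 = v.round) ∧
  (∀ u ∈ v.weakEdges, u.round + 1 < v.round) ∧
  (∀ u, v.leaderEdge = some u → S.IsLeaderVertex v.round v ∧
    S.IsLeaderVertex u.round u ∧ u.round + 1 < v.round)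

/-- All signatures in the certificate verify, and they form a quorum: signatures of Byzantine
parties are free, those of honest parties exist only if they were issued. -/
def VerifiedTC (S : System n Tx) (net : Set (Fin n × Msg n Tx)) (c : TimeoutCert n) : Prop :=
  n - S.f ≤ c.signers.card ∧
  ∀ q ∈ c.signers, S.Honest q → (q, Msg.timeout c.round) ∈ net

/-- The vote supports the leader vertex of the previous round. -/
def SupportsLeader (S : System n Tx) (vt : Vote n Tx) : Prop :=
  ∃ u, vt.strongEdge = some u ∧ S.IsLeaderVertex (vt.round - 1) u

/-- All signatures inside the message verify. -/
def Verified (S : System n Tx) (net : Set (Fin n × Msg n Tx)) : Msg n Tx → Prop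
  | .vote _ => True
  | .timeout _ => True
  | .first _ => True
  | .tc c => S.VerifiedTC net c
  | .pvc r Q => ∀ q ∈ Q, S.Honest q →
      ∃ vt : Vote n Tx, (q, Msg.vote vt) ∈ net ∧ vt.round = r ∧ vt.propose = true
  | .npvc r Q => ∀ q ∈ Q, S.Honest q →
      ∃ vt : Vote n Tx, (q, Msg.vote vt) ∈ net ∧ vt.round = r ∧ vt.propose = false
  | .cvc r Q => ∀ q ∈ Q, S.Honest q →
      ∃ vt : Vote n Tx, (q, Msg.vote vt) ∈ net ∧ vt.round = r ∧ S.SupportsLeader vt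

/-- The round of the leader edge, and `0` when there is none. -/
def leaderBase (v : Vertex n Tx) : ℕ := (v.leaderEdge.map Vertex.round).getD 0

/-- `is_valid(v)` for a leader vertex `v` of round `r`: it has a strong edge to the leader vertex
of round `r - 1`, or it carries timeout certificates for all rounds strictly between the round of
its leader edge and `r` (for all rounds from `1` to `r - 1` if it has no leader edge). -/
def IsValid (S : System n Tx) (net : Set (Fin n × Msg n Tx)) (v : Vertex n Tx) : Prop :=
  (∃ u ∈ v.strongEdges, u.source = S.leader (v.round - 1)) ∨
  ∀ r', leaderBase v < r' → r' < v.round → ∃ c ∈ v.tc, c.round = r' ∧ S.VerifiedTC net c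

/-! ## Protocol rules of an honest party -/

/-- The party has received `TC_r`. -/
def HasTC (S : System n Tx) (s : LocalState n Tx) (r : ℕ) : Prop :=
  n - S.f ≤ (s.timeoutSigs r).card

/-- Round `r` may be left: the leader vertex of round `r` or `TC_r` has been received. The leader
of round `r + 1` moreover waits for timeout certificates of all rounds after the last round whose
leader vertex it has. -/
def MayLeave (S : System n Tx) (i : Fin n) (s : LocalState n Tx) (r : ℕ) : Prop :=
  S.HasLeader s r ∨
  (S.HasTC s r ∧ (i = S.leader (r + 1) →
    ∃ r' < r, (r' = 0 ∨ S.HasLeader s r') ∧ ∀ r'', r' < r'' → r'' ≤ r → S.HasTC s r''))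

/-- The leader edge and the certificates that an honest leader puts into a vertex `v` without a
strong edge to the previous leader vertex: the edge goes to its latest leader vertex before the
previous round (if any), with certificates for all rounds in between. -/
def SkipsCorrectly (S : System n Tx) (s : LocalState n Tx) (v : Vertex n Tx) : Prop :=
  (∀ u, v.leaderEdge = some u →
    u ∈ s.dag ∧ S.IsLeaderVertex u.round u ∧ u.round + 1 < v.round) ∧
  (∀ r', leaderBase v < r' → r' + 1 < v.round → ¬ S.HasLeader s r') ∧
  (∀ r', leaderBase v < r' → r' < v.round → ∃ c ∈ v.tc, c.round = r') ∧
  (∀ c ∈ v.tc, leaderBase v < c.round ∧ c.round < v.round ∧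
    n - S.f ≤ c.signers.card ∧ c.signers ⊆ s.timeoutSigs c.round)

/-- Weak edges go to vertices of rounds `≤ v.round - 2` that `v` does not reach otherwise; every
vertex of these rounds is reached, unless `v` already has `n - f` weak edges. -/
def WeakEdgesCorrect (S : System n Tx) (s : LocalState n Tx) (v : Vertex n Tx) : Prop :=
  (∀ u ∈ v.weakEdges, u ∈ s.dag ∧ u.round + 1 < v.round ∧
    ∀ w ∈ v.refs, Path s.dag w u → w = u ∧ w ∉ v.strongEdges ∧ v.leaderEdge ≠ some w) ∧
  (∀ u ∈ s.dag, u.round + 1 < v.round →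
    Path s.dag v u ∨ n - S.f ≤ v.weakEdges.toFinset.card)

open Classical in
/-- `v` is a possible result of `create_new_vertex` by party `i` in its current round. -/
def MayPropose (S : System n Tx) (i : Fin n) (s : LocalState n Tx) (v : Vertex n Tx) : Prop :=
  v.round = s.round ∧ v.source = i ∧ v.block = s.queue.headD [] ∧
  (1 < s.round → s.jumped = false →
    (s.vertexProposers (s.round - 2)).card - S.f ≤ (s.layer (s.round - 1)).card) ∧
  (∀ u, u ∈ v.strongEdges ↔ u ∈ s.dag ∧ u.round + 1 = s.round ∧
    ¬ (s.round - 1 ∈ s.timeoutSent ∧ u.source = S.leader (s.round - 1))) ∧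
  (if i = S.leader s.round ∧ ¬ ∃ u ∈ v.strongEdges, u.source = S.leader (s.round - 1) then
    S.SkipsCorrectly s v
  else v.leaderEdge = none ∧ v.tc = []) ∧
  S.WeakEdgesCorrect s v

/-- `vt` is a possible result of `create_new_vote` by party `i` in its current round. -/
def MayVote (S : System n Tx) (i : Fin n) (s : LocalState n Tx) (vt : Vote n Tx) : Prop :=
  i ≠ S.leader s.round ∧ vt.round = s.round ∧ vt.source = i ∧
  vt.strongEdge =
    if s.round - 1 ∈ s.timeoutSent then none else S.getLeader s (s.round - 1)

/-- All references of `v` are in the DAG. -/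
def Addable (s : LocalState n Tx) (v : Vertex n Tx) : Prop := ∀ u ∈ v.refs, u ∈ s.dag

/-- Move `v` into the DAG. -/
noncomputable def addToDag (s : LocalState n Tx) (v : Vertex n Tx) : LocalState n Tx :=
  { s with dag := insert v s.dag, buffer := s.buffer.erase v }

open Classical in
/-- Reaction to `r_deliver(v, r, k)`. -/
noncomputable def onDeliver (S : System n Tx) (net : Set (Fin n × Msg n Tx))
    (s : LocalState n Tx) (v : Vertex n Tx) (r : ℕ) (k : Fin n) : LocalState n Tx :=
  if v.source = k ∧ v.round = r ∧ S.WellFormed v ∧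
      (v.source = S.leader r → S.IsValid net v) then
    let s' := if v.propose = true then
      { s with vertexProposers :=
          Function.update s.vertexProposers r (insert k (s.vertexProposers r)) } else s
    if Addable s' v then addToDag s' v else { s' with buffer := insert v s'.buffer }
  else s

open Classical in
/-- Reaction to receiving a verified message `m` from `p`. -/
noncomputable def onReceive (S : System n Tx) (s : LocalState n Tx) (p : Fin n) :
    Msg n Tx → LocalState n Tx
  | .vote vt =>
    if vt.source = p then
      let r := vt.round
      { s with
        vertexProposers := if vt.propose = true then
          Function.update s.vertexProposers r (insert p (s.vertexProposers r))
          else s.vertexProposers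
        sigPropose := if vt.propose = true then
          Function.update s.sigPropose r (insert p (s.sigPropose r)) else s.sigPropose
        sigNoPropose := if vt.propose = true then s.sigNoPropose else
          Function.update s.sigNoPropose r (insert p (s.sigNoPropose r))
        sigCommit := if S.SupportsLeader vt then
          Function.update s.sigCommit r (insert p (s.sigCommit r)) else s.sigCommit }
    else s
  | .timeout r =>
    { s with timeoutSigs := Function.update s.timeoutSigs r (insert p (s.timeoutSigs r)) }
  | .first v => if v.source = p then { s with firstMsgs := insert v s.firstMsgs } else s
  | .tc c =>
    { s with timeoutSigs :=
        Function.update s.timeoutSigs c.round (s.timeoutSigs c.round ∪ c.signers) }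
  | .pvc r Q =>
    { s with
      sigPropose := Function.update s.sigPropose r (s.sigPropose r ∪ Q)
      vertexProposers := Function.update s.vertexProposers r (s.vertexProposers r ∪ Q) }
  | .npvc r Q =>
    { s with sigNoPropose := Function.update s.sigNoPropose r (s.sigNoPropose r ∪ Q) }
  | .cvc r Q => { s with sigCommit := Function.update s.sigCommit r (s.sigCommit r ∪ Q) }

/-- The bookkeeping of `advance_round(r)`; the vertex or vote is sent by a later action. -/
def enterRound (s : LocalState n Tx) (r : ℕ) (jumped : Bool) : LocalState n Tx :=
  { s with round := r, sent := false, jumped := jumped }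

/-! ## Commit rule -/

open Classical in
/-- The parties known to support the leader vertex of round `r`: the senders of first messages of
round `r + 1` vertices with a strong edge to it, and the signers of round `r + 1` votes for it. -/
noncomputable def supporters (S : System n Tx) (s : LocalState n Tx) (r : ℕ) : Finset (Fin n) :=
  (s.firstMsgs.filter (fun w => w.round = r + 1 ∧
    ∃ u ∈ w.strongEdges, S.IsLeaderVertex r u)).image Vertex.source ∪ s.sigCommit (r + 1)

/-- Party may directly commit `v`. -/
def MayCommit (S : System n Tx) (s : LocalState n Tx) (v : Vertex n Tx) : Prop :=
  v ∈ s.dag ∧ S.IsLeaderVertex v.round v ∧ s.committedRound < v.round ∧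
  n - S.f ≤ (S.supporters s v.round).card

open Classical in
/-- The loop of `commit_leader`: going down from round `r`, the leader vertices with a leader path
from the last pushed vertex `v'` are pushed on the stack, until the last committed round. -/
noncomputable def pushLeaders (S : System n Tx) (s : LocalState n Tx) :
    ℕ → Vertex n Tx → List (Vertex n Tx) → List (Vertex n Tx)
  | 0, _, stack => stack
  | r + 1, v', stack =>
    if s.committedRound < r + 1 then
      match S.getLeader s (r + 1) with
      | some u =>
        if S.LeaderPath s.dag v' u then pushLeaders S s r u (u :: stack)
        else pushLeaders S s r v' stack
      | none => pushLeaders S s r v' stack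
    else stack

open Classical in
/-- Deliver the part of the causal history of `v` that has not been delivered yet. -/
noncomputable def orderHistory (S : System n Tx) (s : LocalState n Tx) (v : Vertex n Tx) :
    LocalState n Tx :=
  let new := s.dag.filter (fun u => Path s.dag v u ∧ u ∉ s.delivered)
  { s with
    delivered := s.delivered ∪ new
    out := s.out ++ (S.order new).map (fun u => (u.block, u.round, u.source)) }

/-- `commit_leader(v)` followed by `order_vertices()`, which pops the stack. -/
noncomputable def commitLeader (S : System n Tx) (s : LocalState n Tx) (v : Vertex n Tx) :
    LocalState n Tx :=
  (S.pushLeaders s (v.round - 1) v [v]).foldl (fun s' w => S.orderHistory s' w)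
    { s with committedRound := v.round }

end System

/-! ## Executions -/

/-- The actions of honest parties. Byzantine parties act through the messages and the reliable
broadcast deliveries that honest parties receive from them. -/
inductive Action (n : ℕ) (Tx : Type u) : Type u where
  /-- nothing happens at honest parties -/
  | idle
  /-- `i` calls `a_bcast` on the block `b` -/
  | aBcast (i : Fin n) (b : List Tx)
  /-- `i` creates its vertex `v` of the current round and calls `r_bcast(v, v.round)` -/
  | rBcast (i : Fin n) (v : Vertex n Tx)
  /-- `i` multicasts its vote of the current round -/
  | vote (i : Fin n) (vt : Vote n Tx)
  /-- the timer of the current round of `i` expires -/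
  | timeout (i : Fin n)
  /-- `i` multicasts a timeout certificate that it has received -/
  | relayTC (i : Fin n) (c : TimeoutCert n)
  /-- `i` receives the message `m` from `p` -/
  | receive (i p : Fin n) (m : Msg n Tx)
  /-- `i` outputs `r_deliver(v, r, k)` -/
  | rDeliver (i : Fin n) (v : Vertex n Tx) (r : ℕ) (k : Fin n)
  /-- `i` adds a buffered vertex to its DAG -/
  | unbuffer (i : Fin n) (v : Vertex n Tx)
  /-- `i` enters the next round -/
  | advance (i : Fin n)
  /-- `i` jumps to round `r + 1` -/
  | jump (i : Fin n) (r : ℕ)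
  /-- `i` directly commits the leader vertex `v` -/
  | commit (i : Fin n) (v : Vertex n Tx)

namespace System

variable {n : ℕ} {Tx : Type u}

/-- When an action is possible. Delivery times and timers are left to the adversary. -/
def Enabled (S : System n Tx) (c : Config n Tx) : Action n Tx → Prop
  | .idle => True
  | .aBcast i _ => S.Honest i
  | .rBcast i v => S.Honest i ∧ (c.loc i).sent = false ∧ S.MayPropose i (c.loc i) v
  | .vote i vt => S.Honest i ∧ (c.loc i).sent = false ∧ S.MayVote i (c.loc i) vt
  | .timeout i => S.Honest i ∧ ¬ S.HasLeader (c.loc i) (c.loc i).round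
  | .relayTC i tc => S.Honest i ∧ (c.loc i).round ≤ tc.round ∧ n - S.f ≤ tc.signers.card ∧
      tc.signers ⊆ (c.loc i).timeoutSigs tc.round
  | .receive i p m => S.Honest i ∧ (S.Honest p → (p, m) ∈ c.net) ∧ S.Verified c.net m
  | .rDeliver i _ _ _ => S.Honest i
  | .unbuffer i v => S.Honest i ∧ v ∈ (c.loc i).buffer ∧ Addable (c.loc i) v
  | .advance i => S.Honest i ∧ n - S.f ≤ (c.loc i).heard (c.loc i).round ∧
      S.MayLeave i (c.loc i) (c.loc i).round
  | .jump i r => S.Honest i ∧ (c.loc i).round < r ∧ S.f + 1 ≤ (c.loc i).heard r ∧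
      S.MayLeave i (c.loc i) r
  | .commit i v => S.Honest i ∧ S.MayCommit (c.loc i) v

open Classical in
/-- The effect of an action. -/
noncomputable def next (S : System n Tx) (c : Config n Tx) : Action n Tx → Config n Tx
  | .idle => c
  | .aBcast i b => c.upd i { c.loc i with queue := (c.loc i).queue ++ [b] } ∅
  | .rBcast i v => c.upd i
      { addToDag (c.loc i) v with sent := true, queue := (c.loc i).queue.tail } {.first v}
  | .vote i vt => c.upd i { c.loc i with sent := true } {.vote vt}
  | .timeout i => c.upd i
      { c.loc i with timeoutSent := insert (c.loc i).round (c.loc i).timeoutSent }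
      {.timeout (c.loc i).round}
  | .relayTC i tc => c.upd i (c.loc i) {.tc tc}
  | .receive i p m => c.upd i (S.onReceive (c.loc i) p m) ∅
  | .rDeliver i v r k => c.upd i (S.onDeliver c.net (c.loc i) v r k) ∅
  | .unbuffer i v => c.upd i (addToDag (c.loc i) v) ∅
  | .advance i =>
      let s := c.loc i
      c.upd i (enterRound s (s.round + 1) false)
        (if (s.layer s.round).card < n - S.f then
          {.pvc s.round (s.sigPropose s.round), .npvc s.round (s.sigNoPropose s.round)} else ∅)
  | .jump i r => c.upd i (enterRound (c.loc i) (r + 1) true) ∅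
  | .commit i v =>
      let s := c.loc i
      c.upd i (S.commitLeader s v)
        (if (s.firstMsgs.filter (fun w => w.round = v.round + 1 ∧ v ∈ w.strongEdges)).card
            < n - S.f then {.cvc (v.round + 1) (s.sigCommit (v.round + 1))} else ∅)

/-- The configuration after the first `t` actions. -/
noncomputable def run (S : System n Tx) (act : ℕ → Action n Tx) : ℕ → Config n Tx
  | 0 => Config.init n Tx
  | t + 1 => S.next (run S act t) (act t)

/-- Byzantine reliable broadcast, with one instance for each sender `k` and round `r`. -/
structure ReliableBroadcast (S : System n Tx) (act : ℕ → Action n Tx) : Prop where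
  validity : ∀ t k v, act t = .rBcast k v →
    ∀ i, S.Honest i → ∃ t', act t' = .rDeliver i v v.round k
  agreement : ∀ t i v r k, act t = .rDeliver i v r k →
    ∀ j, S.Honest j → ∃ t', act t' = .rDeliver j v r k
  integrity : ∀ t t' i v v' r k, act t = .rDeliver i v r k → act t' = .rDeliver i v' r k → t = t'

/-- An execution of single-leader Angelfish: every action is possible when it is taken, and
vertices are disseminated by reliable broadcast. -/
structure IsExecution (S : System n Tx) (act : ℕ → Action n Tx) : Prop where
  enabled : ∀ t, S.Enabled (S.run act t) (act t)
  rbc : S.ReliableBroadcast act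

/-! ## Total order -/

/-- Party `i` outputs `a_deliver(x)` before `a_deliver(y)`, where `x` and `y` consist of a block,
a round and a creator. -/
def OutputsBefore (S : System n Tx) (act : ℕ → Action n Tx) (i : Fin n)
    (x y : List Tx × ℕ × Fin n) : Prop :=
  ∃ t l₁ l₂, ((S.run act t).loc i).out = l₁ ++ y :: l₂ ∧ x ∈ l₁

/-- Party `i` outputs the block and creator `x` before it outputs the block and creator `y` for
the first time. -/
def OutputsBlockBefore (S : System n Tx) (act : ℕ → Action n Tx) (i : Fin n)
    (x y : List Tx × Fin n) : Prop :=
  ∃ t l₁ l₂, (((S.run act t).loc i).out.map (fun o => (o.1, o.2.2))) = l₁ ++ y :: l₂ ∧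
    x ∈ l₁ ∧ y ∉ l₁

/-- Total order of Byzantine atomic broadcast, for a relation "`i` outputs `x` before `y`". -/
def TotalOrder {α : Type u} (S : System n Tx) (before : Fin n → α → α → Prop) : Prop :=
  ∀ i j, S.Honest i → S.Honest j → ∀ x y, before i x y → ¬ before j y x

/-- Every leader vertex of a round after `v.round` in the DAG of any honest party, at any time,
has a leader path to each leader vertex `v` that some honest party directly commits. -/
def LeadersReachCommitted (S : System n Tx) (act : ℕ → Action n Tx) : Prop :=
  ∀ t i v, act t = .commit i v → ∀ j, S.Honest j → ∀ t',
    ∀ w ∈ ((S.run act t').loc j).dag, S.IsLeaderVertex w.round w → v.round < w.round →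
      S.LeaderPath ((S.run act t').loc j).dag w v

end System

end Angelfish

/-! The heart is a quorum intersection. If `n - f` parties support the round `r` leader vertex `v`
and `n - f` parties signed a timeout for round `r`, at least `n - 2f > f` parties did both, so some
honest party did both. An honest party supports a round only after leaving it without a timeout, and
it sends timeouts only for its current round. Hence a direct commit in round `r` rules out any
timeout certificate for `r` at any time (`sentInv_run`, `not_timeoutQuorum_of_quorum_supporters`).

A later accepted leader vertex either has a strong edge to the previous leader vertex or carries
certificates for every round that it skips. It cannot skip round `r`, so it steps to a leader vertex
of a round still at least `r`. Induction on rounds gives a leader path to `v`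
(`leaderReach_of_commit`).

Reliable broadcast leaves at most one accepted vertex per round and source, and local graphs contain
all references of their vertices. Reachability and the commit loop therefore do not depend on whose
graph is used. The descent from a direct commit passes through every earlier direct commit, and from
there on it depends only on that vertex. So the leader sequences of any two direct commits are
prefix-comparable (`Committed.leaderSeq_prefix`).

The outputs of an honest party are a fixed fold over the leader sequence of its last direct commit,
so any two honest output lists are prefix-comparable (`out_prefix_or_prefix`). Both forms of total
order then reduce to facts about positions in a single list. -/

namespace Angelfish

namespace System

variable {n : ℕ} {Tx : Type u}

/-! ## Reachability without reference to a local graph -/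

/-- `u` is in the causal history of `v`. -/
def Reach (v u : Vertex n Tx) : Prop := Relation.ReflTransGen (fun a b => b ∈ a.refs) v u

/-- There is a leader path from `v` to `u`. -/
def LeaderReach (S : System n Tx) (v u : Vertex n Tx) : Prop :=
  S.IsLeaderVertex v.round v ∧
  Relation.ReflTransGen (fun a b => S.IsLeaderVertex b.round b ∧
    (b ∈ a.strongEdges ∨ a.leaderEdge = some b)) v u

/-- The DAG contains all vertices that its vertices reference. -/
def RefClosed (D : Finset (Vertex n Tx)) : Prop := ∀ v ∈ D, ∀ u ∈ v.refs, u ∈ D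

theorem mem_refs_of_leaderStep {a b : Vertex n Tx}
    (h : b ∈ a.strongEdges ∨ a.leaderEdge = some b) : b ∈ a.refs := by
  rcases h with h | h <;> simp [Vertex.refs, h]

/-- Closedness makes the restriction to the local graph vacuous, so parties with different graphs
agree on the causal history of a common vertex. -/
theorem RefClosed.path_iff {D : Finset (Vertex n Tx)} (hD : RefClosed D) {v u : Vertex n Tx}
    (hv : v ∈ D) : Path D v u ↔ Reach v u := by
  constructor
  · exact Relation.ReflTransGen.mono (fun _ _ h => h.2) _ _
  · intro h
    suffices u ∈ D ∧ Path D v u from this.2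
    induction h with
    | refl => exact ⟨hv, .refl⟩
    | tail _ hbc ih => exact ⟨hD _ ih.1 _ hbc, ih.2.tail ⟨hD _ ih.1 _ hbc, hbc⟩⟩

theorem RefClosed.mem_of_reach {D : Finset (Vertex n Tx)} (hD : RefClosed D) {v u : Vertex n Tx}
    (hv : v ∈ D) (h : Reach v u) : u ∈ D := by
  induction h with
  | refl => exact hv
  | tail _ hbc ih => exact hD _ ih _ hbc

theorem LeaderReach.reach {S : System n Tx} {v u : Vertex n Tx} (h : S.LeaderReach v u) :
    Reach v u :=
  Relation.ReflTransGen.mono (fun _ _ h => mem_refs_of_leaderStep h.2) _ _ h.2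

theorem RefClosed.leaderPath_iff {S : System n Tx} {D : Finset (Vertex n Tx)} (hD : RefClosed D)
    {v u : Vertex n Tx} (hv : v ∈ D) : S.LeaderPath D v u ↔ S.LeaderReach v u := by
  refine and_congr_right fun _ => ⟨Relation.ReflTransGen.mono (fun _ _ h => h.2) _ _, fun h => ?_⟩
  suffices u ∈ D ∧ Relation.ReflTransGen (fun a b => b ∈ D ∧ S.IsLeaderVertex b.round b ∧
    (b ∈ a.strongEdges ∨ a.leaderEdge = some b)) v u from this.2
  induction h with
  | refl => exact ⟨hv, .refl⟩
  | tail _ hbc ih =>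
    have := hD _ ih.1 _ (mem_refs_of_leaderStep hbc.2)
    exact ⟨this, ih.2.tail ⟨this, hbc⟩⟩

/-! ## Facts about whole executions -/

/-- Party `q` multicasts `m` at some time. -/
def EverSent (S : System n Tx) (act : ℕ → Action n Tx) (q : Fin n) (m : Msg n Tx) : Prop :=
  ∃ t, (q, m) ∈ (S.run act t).net

/-- A timeout certificate for round `r` can be formed at some time. -/
def TimeoutQuorum (S : System n Tx) (act : ℕ → Action n Tx) (r : ℕ) : Prop :=
  ∃ Q : Finset (Fin n), n - S.f ≤ Q.card ∧
    ∀ q ∈ Q, S.Honest q → S.EverSent act q (.timeout r)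

/-- The properties of a vertex that an honest party has accepted. -/
structure Sound (S : System n Tx) (act : ℕ → Action n Tx) (v : Vertex n Tx) : Prop where
  delivered : ∃ t i, S.Honest i ∧ act t = .rDeliver i v v.round v.source
  one_le_round : 1 ≤ v.round
  strong_round : ∀ u ∈ v.strongEdges, u.round + 1 = v.round
  leader_edge : ∀ u, v.leaderEdge = some u → S.IsLeaderVertex u.round u ∧ u.round + 1 < v.round
  leader_valid : v.source = S.leader v.round →
    (∃ u ∈ v.strongEdges, u.source = S.leader (v.round - 1)) ∨
    ∀ r', leaderBase v < r' → r' < v.round → S.TimeoutQuorum act r'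

/-- Agreement brings both vertices to one honest party in the same broadcast instance; integrity
forces the two deliveries to be the same action. This is what prevents equivocation. -/
theorem Sound.eq_of_round_source {S : System n Tx} {act : ℕ → Action n Tx}
    (hact : S.IsExecution act) {v w : Vertex n Tx} (hv : S.Sound act v) (hw : S.Sound act w)
    (hr : v.round = w.round) (hs : v.source = w.source) : v = w := by
  obtain ⟨t, i, -, ht⟩ := hv.delivered
  obtain ⟨t', j, hj, ht'⟩ := hw.delivered
  obtain ⟨t'', ht''⟩ := hact.rbc.agreement _ _ _ _ _ ht j hj
  rw [← hr, ← hs] at ht'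
  have h := hact.rbc.integrity _ _ _ _ _ _ _ ht'' ht'
  subst h
  rw [ht''] at ht'
  simpa using ht'

theorem Sound.eq_of_isLeaderVertex {S : System n Tx} {act : ℕ → Action n Tx}
    (hact : S.IsExecution act) {v w : Vertex n Tx} {r : ℕ} (hv : S.Sound act v)
    (hw : S.Sound act w) (hlv : S.IsLeaderVertex r v) (hlw : S.IsLeaderVertex r w) : v = w :=
  hv.eq_of_round_source hact hw (hlv.1.trans hlw.1.symm) (hlv.2.trans hlw.2.symm)

/-! ### The local invariant and its preservation by each action -/

/-- The invariant of the local state of an honest party. -/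
structure LocalInv (S : System n Tx) (act : ℕ → Action n Tx) (s : LocalState n Tx) : Prop where
  one_le_round : 1 ≤ s.round
  sound_dag : ∀ v ∈ s.dag, S.Sound act v
  closed : RefClosed s.dag
  sound_buffer : ∀ v ∈ s.buffer, S.Sound act v
  timeoutSigs : ∀ r, ∀ q ∈ s.timeoutSigs r, S.Honest q → S.EverSent act q (.timeout r)
  firstMsgs : ∀ v ∈ s.firstMsgs, S.Honest v.source → S.EverSent act v.source (.first v)
  sigCommit : ∀ r, ∀ q ∈ s.sigCommit r, S.Honest q →
    ∃ vt, S.EverSent act q (.vote vt) ∧ vt.round = r ∧ S.SupportsLeader vt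

theorem LocalInv.init (S : System n Tx) (act : ℕ → Action n Tx) :
    S.LocalInv act (LocalState.init n Tx) := by
  constructor <;> simp [LocalState.init, RefClosed]

theorem LocalInv.addToDag {S : System n Tx} {act : ℕ → Action n Tx} {s : LocalState n Tx}
    (hs : S.LocalInv act s) {v : Vertex n Tx} (hv : S.Sound act v) (ha : Addable s v) :
    S.LocalInv act (addToDag s v) where
  one_le_round := hs.one_le_round
  sound_dag := by
    intro w hw
    rcases Finset.mem_insert.1 hw with rfl | hw
    exacts [hv, hs.sound_dag _ hw]
  closed := by
    intro w hw u hu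
    rcases Finset.mem_insert.1 hw with rfl | hw
    exacts [Finset.mem_insert_of_mem (ha u hu), Finset.mem_insert_of_mem (hs.closed _ hw _ hu)]
  sound_buffer := fun w hw => hs.sound_buffer _ (Finset.mem_of_mem_erase hw)
  timeoutSigs := hs.timeoutSigs
  firstMsgs := hs.firstMsgs
  sigCommit := hs.sigCommit

/-- A party puts its own vertex into its graph at once, without the checks made on delivery. The
proposal rules imply those checks, and validity supplies a delivery at an unspecified time; this is
why soundness refers to the whole execution. -/
theorem sound_of_mayPropose {S : System n Tx} {act : ℕ → Action n Tx}
    (hact : S.IsExecution act) {t : ℕ} {i : Fin n} {v : Vertex n Tx} {s : LocalState n Tx}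
    (ht : act t = .rBcast i v) (hi : S.Honest i) (hs : S.LocalInv act s)
    (hv : S.MayPropose i s v) : S.Sound act v ∧ Addable s v := by
  obtain ⟨hr, hsrc, -, -, hstrong, hle, hweak⟩ := hv
  have hedge : ∀ u, v.leaderEdge = some u → S.SkipsCorrectly s v := by
    intro u hu
    split_ifs at hle with h
    · exact hle
    · simp [hle.1] at hu
  refine ⟨⟨?_, hr ▸ hs.one_le_round, fun u hu => hr ▸ ((hstrong u).1 hu).2.1,
    fun u hu => ((hedge u hu).1 u hu).2, fun hl => ?_⟩, fun u hu => ?_⟩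
  · obtain ⟨t', ht'⟩ := hact.rbc.validity _ _ _ ht i hi
    exact ⟨t', i, hi, hsrc ▸ ht'⟩
  · rw [hr]
    by_cases hst : ∃ u ∈ v.strongEdges, u.source = S.leader (s.round - 1)
    · exact .inl hst
    · rw [hsrc, hr] at hl
      rw [if_pos ⟨hl, hst⟩] at hle
      right
      intro r' h1 h2
      obtain ⟨c, hc, rfl⟩ := hle.2.2.1 r' h1 (hr ▸ h2)
      obtain ⟨-, -, h3, h4⟩ := hle.2.2.2 c hc
      exact ⟨c.signers, h3, fun q hq => hs.timeoutSigs _ q (h4 hq)⟩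
  · simp only [Vertex.refs, List.mem_append, Option.mem_toList] at hu
    rcases hu with (hu | hu) | hu
    exacts [((hstrong u).1 hu).1, (hweak.1 u hu).1, ((hedge u hu).1 u hu).1]

open Classical in
theorem LocalInv.onDeliver {S : System n Tx} {act : ℕ → Action n Tx} {t : ℕ} {i k : Fin n}
    {v : Vertex n Tx} {r : ℕ} {s : LocalState n Tx} (ht : act t = .rDeliver i v r k)
    (hi : S.Honest i) (hs : S.LocalInv act s) :
    S.LocalInv act (S.onDeliver (S.run act t).net s v r k) := by
  unfold System.onDeliver
  split_ifs with h h'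
  on_goal 3 => exact hs
  all_goals
    obtain ⟨rfl, rfl, hwf, hval⟩ := h
    have hv : S.Sound act v := by
      refine ⟨⟨t, i, hi, ht⟩, hwf.1, hwf.2.1, fun u hu => (hwf.2.2.2 u hu).2, fun hl => ?_⟩
      refine (hval hl).imp_right fun h r' h1 h2 => ?_
      obtain ⟨c, -, rfl, hc⟩ := h r' h1 h2
      -- The honest signatures were verified against the messages sent up to time `t`.
      exact ⟨c.signers, hc.1, fun q hq hh => ⟨t, hc.2 q hq hh⟩⟩
    dsimp only
    split_ifs with ha
    · exact { hs.addToDag hv ha with }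
    · refine { hs with sound_buffer := fun w hw => ?_ }
      rcases Finset.mem_insert.1 hw with rfl | hw
      exacts [hv, hs.sound_buffer _ hw]

theorem LocalInv.onReceive {S : System n Tx} {act : ℕ → Action n Tx} {t : ℕ} {p : Fin n}
    {m : Msg n Tx} {s : LocalState n Tx} (hp : S.Honest p → (p, m) ∈ (S.run act t).net)
    (hm : S.Verified (S.run act t).net m) (hs : S.LocalInv act s) :
    S.LocalInv act (S.onReceive s p m) := by
  cases m with
  | vote vt =>
    unfold System.onReceive
    dsimp only
    split_ifs with h1 h2 h3 h3
    all_goals try exact { hs with }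
    all_goals
      refine { hs with sigCommit := fun r q hq hh => ?_ }
      by_cases hr : r = vt.round
      · subst hr
        rcases Finset.mem_insert.1 (by simpa using hq) with rfl | hq
        exacts [⟨vt, ⟨t, hp hh⟩, rfl, h3⟩, hs.sigCommit _ _ hq hh]
      · exact hs.sigCommit r q (by simpa [hr] using hq) hh
  | timeout r =>
    refine { hs with timeoutSigs := fun r' q hq hh => ?_ }
    by_cases hr : r' = r
    · subst hr
      rcases Finset.mem_insert.1 (by simpa [System.onReceive] using hq) with rfl | hq
      exacts [⟨t, hp hh⟩, hs.timeoutSigs _ _ hq hh]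
    · exact hs.timeoutSigs r' q (by simpa [System.onReceive, hr] using hq) hh
  | first v =>
    unfold System.onReceive
    dsimp only
    split_ifs with h
    · refine { hs with firstMsgs := fun w hw hh => ?_ }
      rcases Finset.mem_insert.1 hw with rfl | hw
      exacts [⟨t, h ▸ hp (h ▸ hh)⟩, hs.firstMsgs _ hw hh]
    · exact hs
  | tc c =>
    refine { hs with timeoutSigs := fun r' q hq hh => ?_ }
    by_cases hr : r' = c.round
    · subst hr
      rcases Finset.mem_union.1 (by simpa [System.onReceive] using hq) with hq | hq
      exacts [hs.timeoutSigs _ _ hq hh, ⟨t, hm.2 q hq hh⟩]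
    · exact hs.timeoutSigs r' q (by simpa [System.onReceive, hr] using hq) hh
  | pvc r Q => exact { hs with }
  | npvc r Q => exact { hs with }
  | cvc r Q =>
    refine { hs with sigCommit := fun r' q hq hh => ?_ }
    by_cases hr : r' = r
    · subst hr
      rcases Finset.mem_union.1 (by simpa [System.onReceive] using hq) with hq | hq
      · exact hs.sigCommit _ _ hq hh
      · obtain ⟨vt, h1, h2⟩ := hm q hq hh
        exact ⟨vt, ⟨t, h1⟩, h2⟩
    · exact hs.sigCommit r' q (by simpa [System.onReceive, hr] using hq) hh

/-- Committing changes only `committedRound`, `delivered` and `out`. -/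
theorem foldl_orderHistory_eq (S : System n Tx) (l : List (Vertex n Tx)) (s : LocalState n Tx) :
    ∃ d o, l.foldl (fun s' w => S.orderHistory s' w) s = { s with delivered := d, out := o } := by
  induction l generalizing s with
  | nil => exact ⟨s.delivered, s.out, rfl⟩
  | cons w l ih =>
    obtain ⟨d, o, h⟩ := ih (S.orderHistory s w)
    exact ⟨d, o, h⟩

theorem commitLeader_eq (S : System n Tx) (s : LocalState n Tx) (v : Vertex n Tx) :
    ∃ d o, S.commitLeader s v =
      { s with committedRound := v.round, delivered := d, out := o } :=
  foldl_orderHistory_eq S _ _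

theorem onReceive_eq (S : System n Tx) (s : LocalState n Tx) (p : Fin n) (m : Msg n Tx) :
    ∃ a b c d e f, S.onReceive s p m = { s with
      vertexProposers := a, sigPropose := b, sigNoPropose := c, sigCommit := d,
      timeoutSigs := e, firstMsgs := f } := by
  unfold onReceive
  cases m <;> dsimp only <;> (try split_ifs) <;> exact ⟨_, _, _, _, _, _, rfl⟩

theorem onDeliver_eq (S : System n Tx) (net : Set (Fin n × Msg n Tx)) (s : LocalState n Tx)
    (v : Vertex n Tx) (r : ℕ) (k : Fin n) :
    ∃ a d b, S.onDeliver net s v r k = { s with vertexProposers := a, dag := d, buffer := b } ∧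
      s.dag ⊆ d := by
  unfold onDeliver
  split_ifs with h h'
  on_goal 3 => exact ⟨_, _, _, rfl, subset_rfl⟩
  all_goals
    dsimp only
    split_ifs
    exacts [⟨_, _, _, rfl, Finset.subset_insert _ _⟩, ⟨_, _, _, rfl, subset_rfl⟩]

theorem Config.upd_loc_self (c : Config n Tx) (i : Fin n) (s : LocalState n Tx)
    (M : Set (Msg n Tx)) : (c.upd i s M).loc i = s := by
  simp [Config.upd]

theorem Config.upd_loc_of_ne (c : Config n Tx) {i j : Fin n} (h : j ≠ i) (s : LocalState n Tx)
    (M : Set (Msg n Tx)) : (c.upd i s M).loc j = c.loc j := by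
  simp [Config.upd, h]

theorem localInv_run {S : System n Tx} {act : ℕ → Action n Tx} (hact : S.IsExecution act)
    (t : ℕ) : ∀ j, S.Honest j → S.LocalInv act ((S.run act t).loc j) := by
  induction t with
  | zero => exact fun _ _ => LocalInv.init S act
  | succ t ih =>
    have key : ∀ i s M, (S.Honest i → S.LocalInv act ((S.run act t).loc i) →
        S.LocalInv act s) → ∀ j, S.Honest j →
        S.LocalInv act (((S.run act t).upd i s M).loc j) := by
      intro i s M h j hj
      by_cases hji : j = i
      · subst hji
        rw [Config.upd_loc_self]
        exact h hj (ih j hj)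
      · rw [Config.upd_loc_of_ne _ hji]
        exact ih j hj
    have hen := hact.enabled t
    rw [run]
    cases ha : act t with
    | idle => exact ih
    | aBcast i b => exact key _ _ _ fun _ hs => { hs with }
    | rBcast i v =>
      rw [ha] at hen
      refine key _ _ _ fun hi hs => ?_
      obtain ⟨h1, h2⟩ := sound_of_mayPropose hact ha hi hs hen.2.2
      exact { hs.addToDag h1 h2 with }
    | vote i vt => exact key _ _ _ fun _ hs => { hs with }
    | timeout i => exact key _ _ _ fun _ hs => { hs with }
    | relayTC i c => exact key _ _ _ fun _ hs => hs
    | receive i p m =>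
      rw [ha] at hen
      exact key _ _ _ fun _ hs => hs.onReceive hen.2.1 hen.2.2
    | rDeliver i v r k => exact key _ _ _ fun hi hs => hs.onDeliver ha hi
    | unbuffer i v =>
      rw [ha] at hen
      exact key _ _ _ fun _ hs => hs.addToDag (hs.sound_buffer v hen.2.1) hen.2.2
    | advance i =>
      exact key _ _ _ fun _ hs => { hs with one_le_round := Nat.succ_le_succ (Nat.zero_le _) }
    | jump i r =>
      exact key _ _ _ fun _ hs => { hs with one_le_round := Nat.succ_le_succ (Nat.zero_le _) }
    | commit i v =>
      refine key _ _ _ fun _ hs => ?_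
      obtain ⟨d, o, h⟩ := commitLeader_eq S ((S.run act t).loc i) v
      rw [h]
      exact { hs with }

/-! ## Support excludes timeouts -/

/-- What the messages sent by `q` say about its local state: `q` records the rounds for which it
sent a timeout, and it has left each round whose leader vertex it supports, without timeout. -/
structure SentInv (S : System n Tx) (net : Set (Fin n × Msg n Tx)) (q : Fin n)
    (s : LocalState n Tx) : Prop where
  timeout : ∀ r, (q, Msg.timeout r) ∈ net → r ∈ s.timeoutSent
  first : ∀ w r, (q, Msg.first w) ∈ net → w.round = r + 1 →
    (∃ u ∈ w.strongEdges, S.IsLeaderVertex r u) → r ∉ s.timeoutSent ∧ r < s.round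
  vote : ∀ vt r, (q, Msg.vote vt) ∈ net → vt.round = r + 1 → S.SupportsLeader vt →
    r ∉ s.timeoutSent ∧ r < s.round

theorem SentInv.congr {S : System n Tx} {net net' : Set (Fin n × Msg n Tx)} {q : Fin n}
    {s s' : LocalState n Tx} (h : S.SentInv net q s) (h1 : s'.timeoutSent = s.timeoutSent)
    (h2 : s.round ≤ s'.round) (h3 : ∀ r, (q, Msg.timeout r) ∈ net' → (q, Msg.timeout r) ∈ net)
    (h4 : ∀ w, (q, Msg.first w) ∈ net' → (q, Msg.first w) ∈ net)
    (h5 : ∀ vt, (q, Msg.vote vt) ∈ net' → (q, Msg.vote vt) ∈ net) : S.SentInv net' q s' where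
  timeout r hr := h1 ▸ h.timeout r (h3 r hr)
  first w r hw hr hu := by
    obtain ⟨h6, h7⟩ := h.first w r (h4 w hw) hr hu
    exact ⟨h1 ▸ h6, h7.trans_le h2⟩
  vote vt r hw hr hu := by
    obtain ⟨h6, h7⟩ := h.vote vt r (h5 vt hw) hr hu
    exact ⟨h1 ▸ h6, h7.trans_le h2⟩

theorem sentInv_run {S : System n Tx} {act : ℕ → Action n Tx} (hact : S.IsExecution act)
    (t : ℕ) : ∀ q, S.SentInv (S.run act t).net q ((S.run act t).loc q) := by
  induction t with
  | zero => intro q; constructor <;> simp [run, Config.init]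
  | succ t ih =>
    have key : ∀ i s M, S.SentInv ((S.run act t).upd i s M).net i s → ∀ q,
        S.SentInv ((S.run act t).upd i s M).net q (((S.run act t).upd i s M).loc q) := by
      intro i s M h q
      by_cases hq : q = i
      · subst hq
        rwa [Config.upd_loc_self]
      · rw [Config.upd_loc_of_ne _ hq]
        refine (ih q).congr rfl le_rfl ?_ ?_ ?_ <;>
        · intro x hx
          simpa [Config.upd, Ne.symm hq] using hx
    -- This covers all actions that send no vertex, vote or timeout. Certificates are not among the
    -- messages that the invariant constrains.
    have silent : ∀ i s M, s.timeoutSent = ((S.run act t).loc i).timeoutSent →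
        ((S.run act t).loc i).round ≤ s.round → (∀ r, Msg.timeout r ∉ M) →
        (∀ w, Msg.first w ∉ M) → (∀ vt, Msg.vote vt ∉ M) → ∀ q,
        S.SentInv ((S.run act t).upd i s M).net q (((S.run act t).upd i s M).loc q) := by
      intro i s M h1 h2 h3 h4 h5
      refine key i s M ((ih i).congr h1 h2 ?_ ?_ ?_) <;> intro x hx
      · simpa [Config.upd, h3] using hx
      · simpa [Config.upd, h4] using hx
      · simpa [Config.upd, h5] using hx
    have hen := hact.enabled t
    rw [run]
    cases ha : act t with
    | idle => exact ih
    | aBcast i b => exact silent _ _ _ rfl le_rfl (by simp) (by simp) (by simp)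
    | rBcast i v =>
      rw [ha] at hen
      obtain ⟨-, -, hr, -, -, -, hstrong, -⟩ := hen
      refine key _ _ _ ⟨fun r hr' => ?_, fun w r hw hwr hu => ?_, fun vt r hvt => ?_⟩
      · exact (ih i).timeout r (by simpa [Config.upd] using hr')
      · have hw' : w = v ∨ (i, Msg.first w) ∈ (S.run act t).net := by
          simpa [Config.upd, eq_comm] using hw
        rcases hw' with rfl | hw'
        · obtain ⟨u, hu, hul⟩ := hu
          -- The proposer is in round `r + 1`, and the strong-edge rule drops the round `r` leader
          -- vertex once a timeout for `r` was sent.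
          have h := ((hstrong u).1 hu).2.2
          rw [← hr, hwr, Nat.add_sub_cancel] at h
          refine ⟨fun h' => h ⟨h', hul.2⟩, ?_⟩
          change r < ((S.run act t).loc i).round
          omega
        · exact (ih i).first w r hw' hwr hu
      · exact (ih i).vote vt r (by simpa [Config.upd] using hvt)
    | vote i vt =>
      rw [ha] at hen
      obtain ⟨-, -, -, hr, -, hedge⟩ := hen
      refine key _ _ _ ⟨fun r hr' => ?_, fun w r hw => ?_, fun vt' r hvt hvr hu => ?_⟩
      · exact (ih i).timeout r (by simpa [Config.upd] using hr')
      · exact (ih i).first w r (by simpa [Config.upd] using hw)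
      · have hvt' : vt' = vt ∨ (i, Msg.vote vt') ∈ (S.run act t).net := by
          simpa [Config.upd, eq_comm] using hvt
        rcases hvt' with rfl | hvt'
        · obtain ⟨u, hu, hul⟩ := hu
          rw [hu, ← hr, hvr, Nat.add_sub_cancel] at hedge
          refine ⟨fun h' => ?_, ?_⟩
          · simp only at h'
            simp [h'] at hedge
          · change r < ((S.run act t).loc i).round
            omega
        · exact (ih i).vote vt' r hvt' hvr hu
    | timeout i =>
      refine key _ _ _ ⟨fun r hr' => ?_, fun w r hw hwr hu => ?_, fun vt r hvt hvr hu => ?_⟩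
      · have hr'' : r = ((S.run act t).loc i).round ∨ (i, Msg.timeout r) ∈ (S.run act t).net := by
          simpa [Config.upd, eq_comm] using hr'
        exact Finset.mem_insert.2 (hr''.imp_right ((ih i).timeout r))
      · obtain ⟨h1, h2⟩ := (ih i).first w r (by simpa [Config.upd] using hw) hwr hu
        -- The new timeout is for the current round, whereas every supported round is strictly
        -- smaller; the bound `r < s.round` is in the invariant for this purpose.
        exact ⟨fun h => (Finset.mem_insert.1 h).elim h2.ne h1, h2⟩
      · obtain ⟨h1, h2⟩ := (ih i).vote vt r (by simpa [Config.upd] using hvt) hvr hu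
        exact ⟨fun h => (Finset.mem_insert.1 h).elim h2.ne h1, h2⟩
    | relayTC i c => exact silent _ _ _ rfl le_rfl (by simp) (by simp) (by simp)
    | receive i p m =>
      obtain ⟨_, _, _, _, _, _, h⟩ := onReceive_eq S ((S.run act t).loc i) p m
      exact silent _ _ _ (by rw [h]) (by rw [h]) (by simp) (by simp) (by simp)
    | rDeliver i v r k =>
      obtain ⟨_, _, _, h, -⟩ := onDeliver_eq S (S.run act t).net ((S.run act t).loc i) v r k
      exact silent _ _ _ (by rw [h]) (by rw [h]) (by simp) (by simp) (by simp)
    | unbuffer i v => exact silent _ _ _ rfl le_rfl (by simp) (by simp) (by simp)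
    | advance i =>
      refine silent _ _ _ rfl (Nat.le_succ _) ?_ ?_ ?_ <;> intro x <;> split_ifs <;> simp
    | jump i r =>
      rw [ha] at hen
      exact silent _ _ _ rfl (hen.2.1.le.trans (Nat.le_succ _)) (by simp) (by simp) (by simp)
    | commit i v =>
      obtain ⟨d, o, h⟩ := commitLeader_eq S ((S.run act t).loc i) v
      refine silent _ _ _ (by rw [h]) (by rw [h]) ?_ ?_ ?_ <;> intro x <;> split_ifs <;> simp

theorem net_subset_run_succ (S : System n Tx) (act : ℕ → Action n Tx) (t : ℕ) :
    (S.run act t).net ⊆ (S.run act (t + 1)).net := by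
  rw [run]
  cases act t <;> first | exact subset_rfl | exact Set.subset_union_left

theorem net_mono (S : System n Tx) (act : ℕ → Action n Tx) :
    Monotone fun t => (S.run act t).net :=
  monotone_nat_of_le_succ (net_subset_run_succ S act)

/-- An honest supporter of a round `r` leader vertex never sends a timeout for round `r`. -/
theorem not_everSent_timeout_of_mem_supporters {S : System n Tx} {act : ℕ → Action n Tx}
    (hact : S.IsExecution act) {s : LocalState n Tx} (hs : S.LocalInv act s) {r : ℕ} {q : Fin n}
    (hq : S.Honest q) (hsupp : q ∈ S.supporters s r) : ¬ S.EverSent act q (.timeout r) := by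
  classical
  -- Support and timeout may be sent at different times, in either order; since messages persist,
  -- both are read off at the later of the two.
  rintro ⟨t, ht⟩
  rcases Finset.mem_union.1 hsupp with h | h
  · obtain ⟨w, hw, rfl⟩ := Finset.mem_image.1 h
    obtain ⟨hw, hwr, hu⟩ := Finset.mem_filter.1 hw
    obtain ⟨t', ht'⟩ := hs.firstMsgs w hw hq
    have inv := sentInv_run hact (max t t') w.source
    exact (inv.first w r (net_mono S act (le_max_right t t') ht') hwr hu).1
      (inv.timeout r (net_mono S act (le_max_left t t') ht))
  · obtain ⟨vt, ⟨t', ht'⟩, hr, hu⟩ := hs.sigCommit _ q h hq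
    have inv := sentInv_run hact (max t t') q
    exact (inv.vote vt r (net_mono S act (le_max_right t t') ht') hr hu).1
      (inv.timeout r (net_mono S act (le_max_left t t') ht))

theorem not_timeoutQuorum_of_quorum_supporters {S : System n Tx} (hf : 3 * S.f < n)
    (hbyz : S.byz.card ≤ S.f) {act : ℕ → Action n Tx} (hact : S.IsExecution act)
    {s : LocalState n Tx} (hs : S.LocalInv act s) {r : ℕ}
    (hsupp : n - S.f ≤ (S.supporters s r).card) : ¬ S.TimeoutQuorum act r := by
  rintro ⟨Q, hQ, hQ'⟩
  have h1 := Finset.card_union_add_card_inter Q (S.supporters s r)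
  have h2 := card_finset_fin_le (Q ∪ S.supporters s r)
  have h3 : Q ∩ S.supporters s r ⊆ S.byz := by
    intro q hq
    by_contra hb
    obtain ⟨hq1, hq2⟩ := Finset.mem_inter.1 hq
    exact not_everSent_timeout_of_mem_supporters hact hs hb hq2 (hQ' q hq1 hb)
  have h4 := Finset.card_le_card h3
  -- The intersection has at least `2(n - f) - n = n - 2f > f` elements, too many to be all
  -- Byzantine.
  omega

theorem leaderReach_of_commit {S : System n Tx} (hf : 3 * S.f < n)
    (hbyz : S.byz.card ≤ S.f) {act : ℕ → Action n Tx} (hact : S.IsExecution act)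
    {t : ℕ} {i : Fin n} {v : Vertex n Tx} (ht : act t = .commit i v)
    {s : LocalState n Tx} (hs : S.LocalInv act s) {w : Vertex n Tx} (hw : w ∈ s.dag)
    (hlw : S.IsLeaderVertex w.round w) (hvw : v.round ≤ w.round) : S.LeaderReach w v := by
  have hen := hact.enabled t
  rw [ht] at hen
  obtain ⟨hi, hvd, hlv, hcr, hsupp⟩ := hen
  have hsi := localInv_run hact t i hi
  have hnq := not_timeoutQuorum_of_quorum_supporters hf hbyz hact hsi hsupp
  obtain ⟨k, hk⟩ : ∃ k, w.round = k := ⟨_, rfl⟩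
  induction k using Nat.strong_induction_on generalizing w with
  | _ k ih =>
    rcases hvw.eq_or_lt with heq | hlt
    · have : w = v := (hs.sound_dag w hw).eq_of_isLeaderVertex hact (hsi.sound_dag v hvd)
        hlw (heq ▸ hlv)
      exact this ▸ ⟨hlw, .refl⟩
    · have hsound := hs.sound_dag w hw
      have step : ∀ u, S.IsLeaderVertex u.round u → u.round < w.round → v.round ≤ u.round →
          (u ∈ w.strongEdges ∨ w.leaderEdge = some u) → S.LeaderReach w v := by
        intro u hlu huw hvu hedge
        have hu := hs.closed w hw u (mem_refs_of_leaderStep hedge)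
        exact ⟨hlw, (ih u.round (hk ▸ huw) hu hlu hvu rfl).2.head ⟨hlu, hedge⟩⟩
      rcases hsound.leader_valid hlw.2 with ⟨u, hu, hul⟩ | hTC
      · have hur := hsound.strong_round u hu
        refine step u ⟨rfl, ?_⟩ (by omega) (by omega) (.inl hu)
        rw [hul, ← hur, Nat.add_sub_cancel]
      -- Were the base below `v.round`, the certificates of `w` would include one for the committed
      -- round.
      · have hbase : v.round ≤ leaderBase w := by
          by_contra! h
          exact hnq (hTC _ h hlt)
        cases he : w.leaderEdge with
        -- Without a leader edge the base defaults to `0`, below every vertex round.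
        | none =>
          simp only [leaderBase, he, Option.map_none, Option.getD_none] at hbase
          have := (hsi.sound_dag v hvd).one_le_round
          omega
        | some u =>
          simp only [leaderBase, he, Option.map_some, Option.getD_some] at hbase
          obtain ⟨h1, h2⟩ := hsound.leader_edge u he
          exact step u h1 (by omega) hbase (.inr he)

/-! ## The sequence of committed leader vertices -/

open Classical in
/-- The round `r` leader vertex that honest parties accept, if there is one. -/
noncomputable def leaderOf (S : System n Tx) (act : ℕ → Action n Tx) (r : ℕ) :
    Option (Vertex n Tx) :=
  if h : ∃ v, S.Sound act v ∧ S.IsLeaderVertex r v then some h.choose else none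

theorem leaderOf_eq_some_iff {S : System n Tx} {act : ℕ → Action n Tx} (hact : S.IsExecution act)
    {r : ℕ} {v : Vertex n Tx} :
    S.leaderOf act r = some v ↔ S.Sound act v ∧ S.IsLeaderVertex r v := by
  unfold leaderOf
  split_ifs with h
  · rw [Option.some_inj]
    constructor
    · rintro rfl
      exact h.choose_spec
    · rintro ⟨h1, h2⟩
      exact h.choose_spec.1.eq_of_isLeaderVertex hact h1 h.choose_spec.2 h2
  · simpa using fun h1 h2 => h ⟨v, h1, h2⟩

open Classical in
/-- The leader vertices of the rounds `lo + 1, …, r`, in increasing order of rounds, that the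
commit loop meets when it goes down from `v`. -/
noncomputable def descend (S : System n Tx) (act : ℕ → Action n Tx) (lo : ℕ) :
    ℕ → Vertex n Tx → List (Vertex n Tx)
  | 0, _ => []
  | r + 1, v =>
    if lo < r + 1 then
      match S.leaderOf act (r + 1) with
      | some u =>
        if S.LeaderReach v u then descend S act lo r u ++ [u] else descend S act lo r v
      | none => descend S act lo r v
    else []

/-- All leader vertices that are committed together with `v` or before it. -/
noncomputable def leaderSeq (S : System n Tx) (act : ℕ → Action n Tx) (v : Vertex n Tx) :
    List (Vertex n Tx) :=
  S.descend act 0 (v.round - 1) v ++ [v]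

/-- The local loop and the global descent can differ only where an accepted leader vertex is missing
from the local graph. Such a vertex is unreachable from the current one, because the graph is
closed, so the descent skips it as well. -/
theorem LocalInv.pushLeaders_eq {S : System n Tx} {act : ℕ → Action n Tx}
    (hact : S.IsExecution act) {s : LocalState n Tx} (hs : S.LocalInv act s) (r : ℕ)
    {v : Vertex n Tx} (hv : v ∈ s.dag) (stack : List (Vertex n Tx)) :
    S.pushLeaders s r v stack = S.descend act s.committedRound r v ++ stack := by
  induction r generalizing v stack with
  | zero => rfl
  | succ r ih =>
    unfold pushLeaders descend
    split_ifs with hlo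
    · by_cases h : S.HasLeader s (r + 1)
      · obtain ⟨u, h1, hu, hlu⟩ : ∃ u, S.getLeader s (r + 1) = some u ∧ u ∈ s.dag ∧
            S.IsLeaderVertex (r + 1) u := ⟨_, dif_pos h, h.choose_spec⟩
        rw [h1, (leaderOf_eq_some_iff hact).2 ⟨hs.sound_dag _ hu, hlu⟩]
        dsimp only
        have h2 : S.LeaderPath s.dag v u ↔ S.LeaderReach v u := hs.closed.leaderPath_iff hv
        by_cases h3 : S.LeaderReach v u
        · rw [if_pos h3, if_pos (h2.2 h3), ih hu, List.append_assoc, List.singleton_append]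
        · rw [if_neg h3, if_neg (mt h2.1 h3), ih hv]
      · have h1 : S.getLeader s (r + 1) = none := by rw [getLeader, dif_neg h]
        rw [h1]
        cases h2 : S.leaderOf act (r + 1) with
        | none => exact ih hv stack
        | some u =>
          have h3 : ¬ S.LeaderReach v u := fun h3 =>
            h ⟨u, hs.closed.mem_of_reach hv h3.reach, ((leaderOf_eq_some_iff hact).1 h2).2⟩
          simp only [h3, if_false]
          exact ih hv stack
    · rfl

theorem RefClosed.mem_of_mem_descend {S : System n Tx} {act : ℕ → Action n Tx}
    {D : Finset (Vertex n Tx)} (hD : RefClosed D) {lo r : ℕ} {v w : Vertex n Tx} (hv : v ∈ D)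
    (hw : w ∈ S.descend act lo r v) : w ∈ D := by
  induction r generalizing v with
  | zero => simp [descend] at hw
  | succ r ih =>
    unfold descend at hw
    split_ifs at hw
    · split at hw
      · split_ifs at hw with h
        · have hu := hD.mem_of_reach hv h.reach
          rcases List.mem_append.1 hw with hw | hw
          · exact ih hu hw
          · exact List.mem_singleton.1 hw ▸ hu
        · exact ih hv hw
      · exact ih hv hw
    · simp at hw

/-- As long as the descent is above the round of `v₀`, its current vertex has a leader path to `v₀`.
It therefore picks up `v₀` in that round and continues from there with no memory of where it
started. -/
theorem descend_zero_eq_append {S : System n Tx} {act : ℕ → Action n Tx}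
    (hact : S.IsExecution act) {D : Finset (Vertex n Tx)} (hD : RefClosed D) {v₀ : Vertex n Tx}
    (h₀ : S.leaderOf act v₀.round = some v₀)
    (hreach : ∀ w ∈ D, S.IsLeaderVertex w.round w → v₀.round ≤ w.round → S.LeaderReach w v₀)
    {r : ℕ} (hr : v₀.round ≤ r) {v : Vertex n Tx} (hv : v ∈ D) (hv₀ : S.LeaderReach v v₀) :
    S.descend act 0 r v = S.leaderSeq act v₀ ++ S.descend act v₀.round r v := by
  have hpos := ((leaderOf_eq_some_iff hact).1 h₀).1.one_le_round
  induction r generalizing v with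
  | zero => omega
  | succ r ih =>
    rcases hr.eq_or_lt with heq | hlt
    -- In the round of `v₀` itself, the descent bounded below by that round is empty, while the full
    -- one takes `v₀` and proceeds from it.
    · unfold descend
      rw [if_pos r.succ_pos, ← heq, h₀, if_neg (lt_irrefl _)]
      simp [hv₀, leaderSeq, heq]
    · have hr' : v₀.round ≤ r := Nat.le_of_lt_succ hlt
      unfold descend
      rw [if_pos r.succ_pos, if_pos hlt]
      cases h : S.leaderOf act (r + 1) with
      | none => exact ih hr' hv hv₀
      | some u =>
        have hlu := ((leaderOf_eq_some_iff hact).1 h).2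
        dsimp only
        split_ifs with hvu
        · have hu := hD.mem_of_reach hv hvu.reach
          rw [ih hr' hu (hreach u hu (hlu.1 ▸ hlu) (hlu.1 ▸ hr)), List.append_assoc]
        · exact ih hr' hv hv₀

/-- Some honest party directly commits `v`. -/
def Committed (S : System n Tx) (act : ℕ → Action n Tx) (v : Vertex n Tx) : Prop :=
  ∃ t i, act t = .commit i v ∧ S.Honest i ∧ S.MayCommit ((S.run act t).loc i) v

theorem committed_of_commit {S : System n Tx} {act : ℕ → Action n Tx}
    (hact : S.IsExecution act) {t : ℕ} {i : Fin n} {v : Vertex n Tx}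
    (ht : act t = .commit i v) : S.Committed act v := by
  have h := hact.enabled t
  rw [ht] at h
  exact ⟨t, i, ht, h⟩

theorem Committed.leaderOf_eq {S : System n Tx} {act : ℕ → Action n Tx}
    (hact : S.IsExecution act) {v : Vertex n Tx} (hv : S.Committed act v) :
    S.leaderOf act v.round = some v := by
  obtain ⟨t, i, -, hi, hd, hl, -⟩ := hv
  exact (leaderOf_eq_some_iff hact).2 ⟨(localInv_run hact t i hi).sound_dag v hd, hl⟩

theorem Committed.leaderSeq_eq_append {S : System n Tx} (hf : 3 * S.f < n)
    (hbyz : S.byz.card ≤ S.f) {act : ℕ → Action n Tx} (hact : S.IsExecution act)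
    {v₀ v : Vertex n Tx} (hv₀ : S.Committed act v₀) (hv : S.Committed act v)
    (hr : v₀.round < v.round) :
    S.leaderSeq act v =
      S.leaderSeq act v₀ ++ (S.descend act v₀.round (v.round - 1) v ++ [v]) := by
  have h₀ := hv₀.leaderOf_eq hact
  obtain ⟨t₀, i₀, ht₀, -⟩ := hv₀
  obtain ⟨t, i, -, hi, hd, hl, -⟩ := hv
  have hs := localInv_run hact t i hi
  have hreach := fun w hw hlw hvw =>
    leaderReach_of_commit (w := w) hf hbyz hact ht₀ hs hw hlw hvw
  rw [leaderSeq, descend_zero_eq_append hact hs.closed h₀ hreach (by omega) hd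
    (hreach v hd hl hr.le), List.append_assoc]

theorem Committed.leaderSeq_prefix {S : System n Tx} (hf : 3 * S.f < n)
    (hbyz : S.byz.card ≤ S.f) {act : ℕ → Action n Tx} (hact : S.IsExecution act)
    {v₀ v : Vertex n Tx} (hv₀ : S.Committed act v₀) (hv : S.Committed act v)
    (hr : v₀.round ≤ v.round) : S.leaderSeq act v₀ <+: S.leaderSeq act v := by
  rcases hr.eq_or_lt with heq | hlt
  · have h := hv.leaderOf_eq hact
    rw [← heq, hv₀.leaderOf_eq hact, Option.some_inj] at h
    rw [h]
  · exact ⟨_, (hv₀.leaderSeq_eq_append hf hbyz hact hv hlt).symm⟩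

/-! ## The outputs as a function of the committed leader vertices -/

open Classical in
/-- The causal history of `v` (empty in case it is infinite). -/
noncomputable def history (v : Vertex n Tx) : Finset (Vertex n Tx) :=
  if h : {u | Reach v u}.Finite then h.toFinset else ∅

/-- A closed finite graph bounds the history, so the default value `∅` is never used for its
vertices. -/
theorem RefClosed.mem_history_iff {D : Finset (Vertex n Tx)} (hD : RefClosed D)
    {v u : Vertex n Tx} (hv : v ∈ D) : u ∈ history v ↔ Reach v u := by
  have h : {u | Reach v u}.Finite :=
    D.finite_toSet.subset fun u hu => hD.mem_of_reach hv hu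
  rw [history, dif_pos h]
  simp

/-- The output made for a vertex. -/
def delivery (v : Vertex n Tx) : List Tx × ℕ × Fin n := (v.block, v.round, v.source)

/-- The effect of processing the leader vertex `w` on the set of delivered vertices and on the
list of outputs. -/
noncomputable def deliverStep (S : System n Tx)
    (p : Finset (Vertex n Tx) × List (List Tx × ℕ × Fin n)) (w : Vertex n Tx) :
    Finset (Vertex n Tx) × List (List Tx × ℕ × Fin n) :=
  (p.1 ∪ (history w \ p.1), p.2 ++ (S.order (history w \ p.1)).map delivery)

/-- The local graph drops out: the newly delivered set depends only on `w` and on what was delivered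
before. -/
theorem orderHistory_eq {S : System n Tx} {s : LocalState n Tx} (hs : RefClosed s.dag)
    {w : Vertex n Tx} (hw : w ∈ s.dag) :
    S.orderHistory s w = { s with
      delivered := (S.deliverStep (s.delivered, s.out) w).1
      out := (S.deliverStep (s.delivered, s.out) w).2 } := by
  classical
  have h : s.dag.filter (fun u => Path s.dag w u ∧ u ∉ s.delivered) =
      history w \ s.delivered := by
    ext u
    rw [Finset.mem_filter, Finset.mem_sdiff, hs.mem_history_iff hw, hs.path_iff hw]
    exact ⟨fun h => h.2, fun h => ⟨hs.mem_of_reach hw h.1, h⟩⟩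
  unfold orderHistory deliverStep
  dsimp only
  rw [← h]
  congr!

theorem foldl_orderHistory {S : System n Tx} {s : LocalState n Tx} (hs : RefClosed s.dag)
    {l : List (Vertex n Tx)} (hl : ∀ w ∈ l, w ∈ s.dag) :
    l.foldl (fun s' w => S.orderHistory s' w) s = { s with
      delivered := (l.foldl S.deliverStep (s.delivered, s.out)).1
      out := (l.foldl S.deliverStep (s.delivered, s.out)).2 } := by
  induction l generalizing s with
  | nil => rfl
  | cons w l ih =>
    rw [List.foldl_cons, List.foldl_cons, orderHistory_eq hs (hl w (by simp)), ih]
    · exact hs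
    · exact fun x hx => hl x (by simp [hx])

theorem deliverStep_foldl_prefix (S : System n Tx) (l : List (Vertex n Tx))
    (p : Finset (Vertex n Tx) × List (List Tx × ℕ × Fin n)) :
    p.2 <+: (l.foldl S.deliverStep p).2 := by
  induction l generalizing p with
  | nil => exact List.prefix_rfl
  | cons w l ih => exact (List.prefix_append _ _).trans (ih (S.deliverStep p w))

/-- The outputs, and the set of delivered vertices, after the leader vertices `l`. -/
noncomputable def outputs (S : System n Tx) (l : List (Vertex n Tx)) :
    Finset (Vertex n Tx) × List (List Tx × ℕ × Fin n) :=
  l.foldl S.deliverStep (∅, [])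

theorem outputs_prefix (S : System n Tx) {l l' : List (Vertex n Tx)} (h : l <+: l') :
    (S.outputs l).2 <+: (S.outputs l').2 := by
  obtain ⟨k, rfl⟩ := h
  rw [outputs, outputs, List.foldl_append]
  exact deliverStep_foldl_prefix S k _

/-- Reduces each invariant about outputs to the single case of a commit by `j`. -/
theorem run_succ_loc (S : System n Tx) (act : ℕ → Action n Tx) (t : ℕ) (j : Fin n) :
    (((S.run act (t + 1)).loc j).committedRound = ((S.run act t).loc j).committedRound ∧
      ((S.run act (t + 1)).loc j).delivered = ((S.run act t).loc j).delivered ∧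
      ((S.run act (t + 1)).loc j).out = ((S.run act t).loc j).out ∧
      ((S.run act t).loc j).dag ⊆ ((S.run act (t + 1)).loc j).dag) ∨
    ∃ v, act t = .commit j v ∧
      (S.run act (t + 1)).loc j = S.commitLeader ((S.run act t).loc j) v := by
  have key : ∀ i s M, (s.committedRound = ((S.run act t).loc i).committedRound ∧
      s.delivered = ((S.run act t).loc i).delivered ∧ s.out = ((S.run act t).loc i).out ∧
      ((S.run act t).loc i).dag ⊆ s.dag) →
      (((S.run act t).upd i s M).loc j).committedRound = ((S.run act t).loc j).committedRound ∧
      (((S.run act t).upd i s M).loc j).delivered = ((S.run act t).loc j).delivered ∧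
      (((S.run act t).upd i s M).loc j).out = ((S.run act t).loc j).out ∧
      ((S.run act t).loc j).dag ⊆ (((S.run act t).upd i s M).loc j).dag := by
    intro i s M h
    by_cases hj : j = i
    · subst hj
      rwa [Config.upd_loc_self]
    · rw [Config.upd_loc_of_ne _ hj]
      exact ⟨rfl, rfl, rfl, subset_rfl⟩
  rw [run]
  cases ha : act t with
  | idle => exact .inl ⟨rfl, rfl, rfl, subset_rfl⟩
  | rBcast i v => exact .inl (key _ _ _ ⟨rfl, rfl, rfl, Finset.subset_insert _ _⟩)
  | unbuffer i v => exact .inl (key _ _ _ ⟨rfl, rfl, rfl, Finset.subset_insert _ _⟩)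
  | receive i p m =>
    obtain ⟨_, _, _, _, _, _, h⟩ := onReceive_eq S ((S.run act t).loc i) p m
    exact .inl (key _ _ _ (by rw [h]; exact ⟨rfl, rfl, rfl, subset_rfl⟩))
  | rDeliver i v r k =>
    obtain ⟨_, _, _, h, h'⟩ := onDeliver_eq S (S.run act t).net ((S.run act t).loc i) v r k
    exact .inl (key _ _ _ (by rw [h]; exact ⟨rfl, rfl, rfl, h'⟩))
  | commit i v =>
    by_cases hj : j = i
    · subst hj
      exact .inr ⟨v, rfl, Config.upd_loc_self ..⟩
    · left
      rw [next, Config.upd_loc_of_ne _ hj]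
      exact ⟨rfl, rfl, rfl, subset_rfl⟩
  | _ => exact .inl (key _ _ _ ⟨rfl, rfl, rfl, subset_rfl⟩)

/-- What an honest party has output is determined by the last leader vertex that it has directly
committed. -/
def OutputInv (S : System n Tx) (act : ℕ → Action n Tx) (s : LocalState n Tx) : Prop :=
  (s.committedRound = 0 ∧ (s.delivered, s.out) = (∅, [])) ∨
  ∃ v, S.Committed act v ∧ v.round = s.committedRound ∧
    (s.delivered, s.out) = S.outputs (S.leaderSeq act v)

theorem LocalInv.commitLeader_eq {S : System n Tx} {act : ℕ → Action n Tx}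
    (hact : S.IsExecution act) {s : LocalState n Tx} (hs : S.LocalInv act s) {v : Vertex n Tx}
    (hv : v ∈ s.dag) :
    S.commitLeader s v = { s with
      committedRound := v.round
      delivered := ((S.descend act s.committedRound (v.round - 1) v ++ [v]).foldl S.deliverStep
        (s.delivered, s.out)).1
      out := ((S.descend act s.committedRound (v.round - 1) v ++ [v]).foldl S.deliverStep
        (s.delivered, s.out)).2 } := by
  rw [commitLeader, hs.pushLeaders_eq hact _ hv]
  refine foldl_orderHistory (s := { s with committedRound := v.round }) hs.closed fun w hw => ?_
  rcases List.mem_append.1 hw with hw | hw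
  · exact hs.closed.mem_of_mem_descend hv hw
  · exact List.mem_singleton.1 hw ▸ hv

theorem outputInv_run {S : System n Tx} (hf : 3 * S.f < n) (hbyz : S.byz.card ≤ S.f)
    {act : ℕ → Action n Tx} (hact : S.IsExecution act) {j : Fin n} (hj : S.Honest j) (t : ℕ) :
    S.OutputInv act ((S.run act t).loc j) := by
  induction t with
  | zero => exact .inl ⟨rfl, rfl⟩
  | succ t ih =>
    rcases run_succ_loc S act t j with ⟨h1, h2, h3, -⟩ | ⟨v, hv, h⟩
    · rwa [OutputInv, h1, h2, h3]
    · obtain hvc := committed_of_commit hact hv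
      have hen := hact.enabled t
      rw [hv] at hen
      obtain ⟨-, hd, -, hlt, -⟩ := hen
      refine .inr ⟨v, hvc, ?_⟩
      rw [h, (localInv_run hact t j hj).commitLeader_eq hact hd]
      refine ⟨rfl, ?_⟩
      rcases ih with ⟨h1, h2⟩ | ⟨v₀, hv₀, hr, h2⟩
      -- At the first commit the lower bound is `0`, so the processed list is the full leader
      -- sequence by definition.
      · rw [h1, h2]
        rfl
      -- The fold resumes where the sequence of the previous commit `v₀` ended. Giving the shape of
      -- `l'` makes the rewrite split there and not before the final `[v]`.
      · rw [h2, ← hr, hv₀.leaderSeq_eq_append hf hbyz hact hvc (hr ▸ hlt), outputs, outputs,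
          List.foldl_append (l' := _ ++ _)]

theorem out_prefix_or_prefix {S : System n Tx} (hf : 3 * S.f < n) (hbyz : S.byz.card ≤ S.f)
    {act : ℕ → Action n Tx} (hact : S.IsExecution act) {i j : Fin n} (hi : S.Honest i)
    (hj : S.Honest j) (t t' : ℕ) :
    ((S.run act t).loc i).out <+: ((S.run act t').loc j).out ∨
      ((S.run act t').loc j).out <+: ((S.run act t).loc i).out := by
  rcases outputInv_run hf hbyz hact hi t with ⟨-, h⟩ | ⟨v, hv, -, h⟩
  · rw [(Prod.mk.inj h).2]
    exact .inl List.nil_prefix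
  rcases outputInv_run hf hbyz hact hj t' with ⟨-, h'⟩ | ⟨v', hv', -, h'⟩
  · rw [(Prod.mk.inj h').2]
    exact .inr List.nil_prefix
  replace h : ((S.run act t).loc i).out = _ := congrArg Prod.snd h
  replace h' : ((S.run act t').loc j).out = _ := congrArg Prod.snd h'
  rw [h, h']
  exact (le_total v.round v'.round).imp
    (fun hr => outputs_prefix S (hv.leaderSeq_prefix hf hbyz hact hv' hr))
    (fun hr => outputs_prefix S (hv'.leaderSeq_prefix hf hbyz hact hv hr))

/-! ## No vertex is output twice -/

/-- The outputs come from distinct vertices of the DAG. -/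
def DistinctOutputs (s : LocalState n Tx) : Prop :=
  ∃ l : List (Vertex n Tx), l.Nodup ∧ (∀ u, u ∈ l ↔ u ∈ s.delivered) ∧
    s.out = l.map delivery ∧ s.delivered ⊆ s.dag

theorem DistinctOutputs.orderHistory {s : LocalState n Tx} (hs : DistinctOutputs s)
    (S : System n Tx) (w : Vertex n Tx) : DistinctOutputs (S.orderHistory s w) := by
  classical
  obtain ⟨l, hl, hmem, hout, hsub⟩ := hs
  refine ⟨l ++ S.order (s.dag.filter fun u => Path s.dag w u ∧ u ∉ s.delivered),
    hl.append (S.order_nodup _) ?_, ?_, ?_, ?_⟩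
  · intro u hu hu'
    rw [S.mem_order, Finset.mem_filter] at hu'
    exact hu'.2.2 ((hmem u).1 hu)
  · intro u
    rw [List.mem_append, S.mem_order, hmem]
    simp [System.orderHistory]
  · rw [List.map_append, ← hout]
    rfl
  · intro u hu
    rcases Finset.mem_union.1 hu with hu | hu
    exacts [hsub hu, (Finset.mem_filter.1 hu).1]

theorem distinctOutputs_run (S : System n Tx) (act : ℕ → Action n Tx) (j : Fin n) (t : ℕ) :
    DistinctOutputs ((S.run act t).loc j) := by
  induction t with
  | zero => exact ⟨[], by simp [run, Config.init, LocalState.init]⟩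
  | succ t ih =>
    rcases run_succ_loc S act t j with ⟨-, h2, h3, h4⟩ | ⟨v, -, h⟩
    · obtain ⟨l, hl, hmem, hout, hsub⟩ := ih
      exact ⟨l, hl, fun u => by rw [h2, hmem], by rw [h3, hout], by rw [h2]; exact hsub.trans h4⟩
    · rw [h]
      have key : ∀ (l : List (Vertex n Tx)) (s : LocalState n Tx), DistinctOutputs s →
          DistinctOutputs (l.foldl (fun s' w => S.orderHistory s' w) s) := by
        intro l
        induction l with
        | nil => exact fun _ hs => hs
        | cons w l ihl => exact fun s hs => ihl _ (hs.orderHistory S w)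
      exact key _ _ ih

/-- Distinct vertices produce distinct outputs because round and source already determine an
accepted vertex. -/
theorem out_nodup {S : System n Tx} {act : ℕ → Action n Tx} (hact : S.IsExecution act)
    {j : Fin n} (hj : S.Honest j) (t : ℕ) : ((S.run act t).loc j).out.Nodup := by
  obtain ⟨l, hl, hmem, hout, hsub⟩ := distinctOutputs_run S act j t
  have hs := localInv_run hact t j hj
  rw [hout]
  refine hl.map_on fun u hu w hw h => ?_
  simp only [delivery, Prod.mk.injEq] at h
  exact (hs.sound_dag u (hsub ((hmem u).1 hu))).eq_of_round_source hact
    (hs.sound_dag w (hsub ((hmem w).1 hw))) h.2.1 h.2.2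

end System

end Angelfish

/-! ### Order of entries in a single list, and the theorem -/

theorem List.Nodup.not_mem_before {α : Type*} {l l₁ l₂ m₁ m₂ : List α} (hl : l.Nodup) {x y : α}
    (h : l₁ ++ y :: l₂ <+: l) (hx : x ∈ l₁) (h' : m₁ ++ x :: m₂ <+: l) : y ∉ m₁ := by
  intro hy
  have h₁ := hl.sublist h.sublist
  have h₂ := hl.sublist h'.sublist
  rw [List.nodup_append] at h₁ h₂
  -- Of the two initial segments one contains the other, so `x` or `y` would occur a second time.
  rcases List.prefix_or_prefix_of_prefix ((List.prefix_append _ _).trans h)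
    ((List.prefix_append _ _).trans h') with c | c
  exacts [h₂.2.2 x (c.subset hx) x (by simp) rfl, h₁.2.2 y (c.subset hy) y (by simp) rfl]

/-- Counting first occurrences replaces the absence of duplicates, which may fail once rounds are
forgotten. -/
theorem List.not_first_before {α : Type*} {l l₁ l₂ m₁ m₂ : List α} {x y : α}
    (h : l₁ ++ y :: l₂ <+: l) (hx : x ∈ l₁) (hy : y ∉ l₁) (h' : m₁ ++ x :: m₂ <+: l)
    (hx' : x ∉ m₁) : y ∉ m₁ := by
  intro hy'
  rcases List.prefix_or_prefix_of_prefix ((List.prefix_append _ _).trans h)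
    ((List.prefix_append _ _).trans h') with c | c
  exacts [hx' (c.subset hx), hy (c.subset hy')]

/-- In every execution of single-leader Angelfish with `n > 3f` parties, of which at most `f` are
Byzantine, Total order holds, and directly committed leader vertices stay reachable by leader
paths from all later leader vertices. -/
theorem mainTheorem6 {Tx : Type*} {n : ℕ} (S : Angelfish.System n Tx)
    (hf : 3 * S.f < n) (hbyz : S.byz.card ≤ S.f)
    (act : ℕ → Angelfish.Action n Tx) (hact : S.IsExecution act) :
    S.TotalOrder (S.OutputsBefore act) ∧
    S.TotalOrder (S.OutputsBlockBefore act) ∧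
    S.LeadersReachCommitted act := by
  refine ⟨?_, ?_, ?_⟩
  · rintro i j hi hj x y ⟨t, l₁, l₂, hl, hx⟩ ⟨t', m₁, m₂, hm, hy⟩
    -- The longer of the two outputs serves as the common list in which both orders are read.
    rcases Angelfish.System.out_prefix_or_prefix hf hbyz hact hi hj t t' with h | h
    · exact (Angelfish.System.out_nodup hact hj t').not_mem_before (hl ▸ h) hx
        ⟨[], by rw [List.append_nil, hm]⟩ hy
    · exact (Angelfish.System.out_nodup hact hi t).not_mem_before ⟨[], by rw [List.append_nil, hl]⟩ hx
        (hm ▸ h) hy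
  · rintro i j hi hj x y ⟨t, l₁, l₂, hl, hx, hy⟩ ⟨t', m₁, m₂, hm, hy', hx'⟩
    rcases Angelfish.System.out_prefix_or_prefix hf hbyz hact hi hj t t' with h | h
    · exact List.not_first_before (hl ▸ h.map _) hx hy ⟨[], by rw [List.append_nil, hm]⟩ hx' hy'
    · exact List.not_first_before ⟨[], by rw [List.append_nil, hl]⟩ hx hy (hm ▸ h.map _) hx' hy'
  · intro t i v ht j hj t' w hw hlw hvw
    have hs := Angelfish.System.localInv_run hact t' j hj
    exact (hs.closed.leaderPath_iff hw).2
      (Angelfish.System.leaderReach_of_commit hf hbyz hact ht hs hw hlw hvw.le)
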